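/- Let $H_1$ and $H_2$ be Hilbert spaces (both real or both complex), and write $N(A)$ and $R(A)$ for the null space and the range of a bounded linear operator $A$. A pair $(S,T)$ of bounded linear operators $S\colon H_1\to H_2$ and $T\colon H_2\to H_1$ is called a Fredholm pair if the dimensions $$a=\dim \frac{N(S)}{N(S)\cap R(T)},\quad b=\dim \frac{R(T)}{N(S)\cap R(T)},\quad c=\dim \frac{N(T)}{N(T)\cap R(S)},\quad d=\dim \frac{R(S)}{N(T)\cap R(S)}$$ are all finite; its index is then $\operatorname{ind}(S,T)=a-b-c+d$. If $(S,T)$ is a Fredholm pair, then there is an $\varepsilon>0$, depending only on $(S,T)$, such that for all bounded linear operators $S_1\colon H_1\to H_2$ and $T_1\colon H_2\to H_1$ for which $R(T_1S_1)$ and $R(S_1T_1)$ are finite dimensional, $\|S-S_1\|<\varepsilon$ and $\|T-T_1\|<\varepsilon$, the pair $(S_1,T_1)$ is a Fredholm pair and $\operatorname{ind}(S,T)=\operatorname{ind}(S_1,T_1)$. -/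

import Mathlib

section FredholmPairs

variable {𝕜 H₁ H₂ : Type*} [RCLike 𝕜]
  [NormedAddCommGroup H₁] [InnerProductSpace 𝕜 H₁]
  [NormedAddCommGroup H₂] [InnerProductSpace 𝕜 H₂]

/-- The quotient `N(S) / (N(S) ∩ R(T))`. -/
abbrev KerModRange (S : H₁ →L[𝕜] H₂) (T : H₂ →L[𝕜] H₁) : Type _ :=
  LinearMap.ker S.toLinearMap ⧸
    (LinearMap.ker S.toLinearMap ⊓ LinearMap.range T.toLinearMap).submoduleOf
      (LinearMap.ker S.toLinearMap)

/-- The quotient `R(T) / (N(S) ∩ R(T))`. -/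
abbrev RangeModKer (S : H₁ →L[𝕜] H₂) (T : H₂ →L[𝕜] H₁) : Type _ :=
  LinearMap.range T.toLinearMap ⧸
    (LinearMap.ker S.toLinearMap ⊓ LinearMap.range T.toLinearMap).submoduleOf
      (LinearMap.range T.toLinearMap)

/-- `(S, T)` is a Fredholm pair: the four quotients `N(S) / (N(S) ∩ R(T))`,
`R(T) / (N(S) ∩ R(T))`, `N(T) / (N(T) ∩ R(S))`, `R(S) / (N(T) ∩ R(S))` are
finite dimensional. -/
structure IsFredholmPair (S : H₁ →L[𝕜] H₂) (T : H₂ →L[𝕜] H₁) : Prop where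
  finite_a : FiniteDimensional 𝕜 (KerModRange S T)
  finite_b : FiniteDimensional 𝕜 (RangeModKer S T)
  finite_c : FiniteDimensional 𝕜 (KerModRange T S)
  finite_d : FiniteDimensional 𝕜 (RangeModKer T S)

/-- The index `a - b - c + d` of a Fredholm pair (meaningful only for Fredholm pairs). -/
noncomputable def fredholmPairIndex (S : H₁ →L[𝕜] H₂) (T : H₂ →L[𝕜] H₁) : ℤ :=
  (Module.finrank 𝕜 (KerModRange S T) : ℤ) - (Module.finrank 𝕜 (RangeModKer S T) : ℤ)
    - (Module.finrank 𝕜 (KerModRange T S) : ℤ) + (Module.finrank 𝕜 (RangeModKer T S) : ℤ)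

end FredholmPairs

/-! The pair is traded for the single operator `S + T†`. If `ST = 0` and `TS = 0`, a Hodge
decomposition identifies the kernel of `S + T†` with `N(S)/R(T)` and its cokernel with `N(T)/R(S)`,
so the pair is Fredholm exactly when `S + T†` is, with equal indices
(`isFredholmPair_iff_add_adjoint`). If the products merely have finite rank, `(S, T)` is a finite
rank perturbation of such a complex (`exists_complex_of_finiteDimensional_range`), and neither side
notices: the index is a difference of relative dimensions of commensurable subspaces, and a finite
rank perturbation shifts kernel and range by opposite amounts
(`IsFredholmPair.of_finiteDimensional_range_sub`). A Fredholm pair has finite rank products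
automatically, so stability reduces to that of the Fredholm operator `S + T†`, which depends
continuously on the pair. -/

namespace Submodule

/-! ### Relative dimension and commensurable subspaces -/

variable {K V W : Type*} [Field K] [AddCommGroup V] [Module K V] [AddCommGroup W] [Module K W]

/-- `U / (U ∩ X)`, realised as the image of `U` in `V / X`, is finite dimensional. -/
def RelFinite (U X : Submodule K V) : Prop :=
  FiniteDimensional K (U.map X.mkQ)

/-- The dimension of `U / (U ∩ X)`, realised as the image of `U` in `V / X`. -/
noncomputable def relDim (U X : Submodule K V) : ℕ :=
  Module.finrank K (U.map X.mkQ)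

/-- The canonical isomorphism `U / (U ∩ X) ≃ (U + X) / X`. -/
noncomputable def quotInfSubmoduleOfEquiv (U X : Submodule K V) :
    (U ⧸ (U ⊓ X).submoduleOf U) ≃ₗ[K] U.map X.mkQ :=
  (Submodule.quotEquivOfEq _ _ (by
    ext x
    simp [Submodule.submoduleOf, LinearMap.mem_ker])).trans
    ((X.mkQ ∘ₗ U.subtype).quotKerEquivRange.trans
      (LinearEquiv.ofEq _ _ (by rw [LinearMap.range_comp, Submodule.range_subtype])))

theorem relFinite_iff (U X : Submodule K V) :
    U.RelFinite X ↔ FiniteDimensional K (U ⧸ (U ⊓ X).submoduleOf U) :=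
  ⟨fun h ↦ have : FiniteDimensional K (U.map X.mkQ) := h
    (quotInfSubmoduleOfEquiv U X).symm.finiteDimensional,
    fun _ ↦ (quotInfSubmoduleOfEquiv U X).finiteDimensional⟩

theorem relDim_eq (U X : Submodule K V) :
    U.relDim X = Module.finrank K (U ⧸ (U ⊓ X).submoduleOf U) :=
  (quotInfSubmoduleOfEquiv U X).finrank_eq.symm

theorem map_mkQ_sup (U X : Submodule K V) : (U ⊔ X).map X.mkQ = U.map X.mkQ := by
  rw [Submodule.map_sup, Submodule.mkQ_map_self, sup_bot_eq]

theorem relFinite_sup_iff {U X : Submodule K V} : (U ⊔ X).RelFinite X ↔ U.RelFinite X := by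
  rw [RelFinite, RelFinite, map_mkQ_sup]

theorem relDim_sup (U X : Submodule K V) : (U ⊔ X).relDim X = U.relDim X := by
  rw [relDim, relDim, map_mkQ_sup]

theorem relFinite_inf_iff {U X : Submodule K V} : U.RelFinite (U ⊓ X) ↔ U.RelFinite X := by
  rw [relFinite_iff, relFinite_iff, ← inf_assoc, inf_idem]

theorem relDim_inf (U X : Submodule K V) : U.relDim (U ⊓ X) = U.relDim X := by
  rw [relDim_eq, relDim_eq, ← inf_assoc, inf_idem]

theorem relFinite_bot_iff {U : Submodule K V} : U.RelFinite ⊥ ↔ FiniteDimensional K U := by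
  have e := Submodule.equivMapOfInjective (⊥ : Submodule K V).mkQ
    (LinearMap.ker_eq_bot.1 (Submodule.ker_mkQ _)) U
  exact ⟨fun h ↦ have : FiniteDimensional K (U.map (⊥ : Submodule K V).mkQ) := h
    e.symm.finiteDimensional, fun _ ↦ e.finiteDimensional⟩

theorem relFinite_top_iff {X : Submodule K V} :
    (⊤ : Submodule K V).RelFinite X ↔ FiniteDimensional K (V ⧸ X) := by
  rw [RelFinite, Submodule.map_top, Submodule.range_mkQ]
  exact ⟨fun _ ↦ Submodule.topEquiv.finiteDimensional,
    fun _ ↦ Submodule.topEquiv.symm.finiteDimensional⟩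

theorem relDim_top (X : Submodule K V) :
    (⊤ : Submodule K V).relDim X = Module.finrank K (V ⧸ X) := by
  rw [relDim, Submodule.map_top, Submodule.range_mkQ, finrank_top]

theorem map_factor_map_mkQ {U X Y : Submodule K V} (h : X ≤ Y) :
    (U.map X.mkQ).map (Submodule.factor h) = U.map Y.mkQ := by
  rw [← Submodule.map_comp, Submodule.factor_comp_mk]

theorem RelFinite.mono_left {U U' X : Submodule K V} (h : U.RelFinite X) (hU : U' ≤ U) :
    U'.RelFinite X :=
  have : FiniteDimensional K (U.map X.mkQ) := h
  Submodule.finiteDimensional_of_le (Submodule.map_mono hU)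

theorem RelFinite.mono_right {U X Y : Submodule K V} (h : U.RelFinite X) (hX : X ≤ Y) :
    U.RelFinite Y := by
  have : FiniteDimensional K (U.map X.mkQ) := h
  rw [RelFinite, ← map_factor_map_mkQ hX]
  infer_instance

theorem map_mkQ_eq_bot_of_le {U X : Submodule K V} (h : U ≤ X) : U.map X.mkQ = ⊥ := by
  rw [eq_bot_iff, Submodule.map_le_iff_le_comap]
  exact fun x hx ↦ by simpa using h hx

theorem RelFinite.of_le {U X : Submodule K V} (h : U ≤ X) : U.RelFinite X := by
  rw [RelFinite, map_mkQ_eq_bot_of_le h]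
  infer_instance

theorem relDim_eq_zero_of_le {U X : Submodule K V} (h : U ≤ X) : U.relDim X = 0 := by
  rw [relDim, map_mkQ_eq_bot_of_le h, finrank_bot]

/-- The restriction of `V / X → V / Y` to the image of `U`. -/
noncomputable def factorRestrict (U : Submodule K V) {X Y : Submodule K V} (h : X ≤ Y) :
    U.map X.mkQ →ₗ[K] V ⧸ Y :=
  Submodule.factor h ∘ₗ (U.map X.mkQ).subtype

theorem range_factorRestrict (U : Submodule K V) {X Y : Submodule K V} (h : X ≤ Y) :
    LinearMap.range (factorRestrict U h) = U.map Y.mkQ := by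
  rw [factorRestrict, LinearMap.range_comp, Submodule.range_subtype, map_factor_map_mkQ]

theorem map_ker_factorRestrict {U X Y : Submodule K V} (h : X ≤ Y) (hYU : Y ≤ U) :
    (LinearMap.ker (factorRestrict U h)).map (U.map X.mkQ).subtype = Y.map X.mkQ := by
  ext z
  constructor
  · rintro ⟨⟨_, x, hx, rfl⟩, hz, rfl⟩
    refine ⟨x, ?_, rfl⟩
    simpa [factorRestrict] using hz
  · rintro ⟨x, hx, rfl⟩
    refine ⟨⟨X.mkQ x, x, hYU hx, rfl⟩, ?_, rfl⟩
    simpa [factorRestrict] using hx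

/-- The kernel of the restriction of `V / X → V / Y` to `U / X` is `Y / X`. -/
noncomputable def kerFactorRestrictEquiv {U X Y : Submodule K V} (h : X ≤ Y) (hYU : Y ≤ U) :
    LinearMap.ker (factorRestrict U h) ≃ₗ[K] Y.map X.mkQ :=
  (Submodule.equivMapOfInjective _ (Submodule.injective_subtype _) _).trans
    (LinearEquiv.ofEq _ _ (map_ker_factorRestrict h hYU))

/-- The map `U/X → V/Y` has kernel `Y/X` and range `U/Y`, both finite dimensional. -/
theorem RelFinite.trans_of_le {U X Y : Submodule K V} (h : X ≤ Y) (hYU : Y ≤ U)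
    (hY : Y.RelFinite X) (hU : U.RelFinite Y) : U.RelFinite X := by
  have : FiniteDimensional K (Y.map X.mkQ) := hY
  have : FiniteDimensional K (U.map Y.mkQ) := hU
  have h1 : FiniteDimensional K (LinearMap.ker (factorRestrict U h)) :=
    (kerFactorRestrictEquiv h hYU).symm.finiteDimensional
  have h2 : FiniteDimensional K (LinearMap.range (factorRestrict U h)) := by
    rw [range_factorRestrict]; infer_instance
  have h3 : FiniteDimensional K (_ ⧸ LinearMap.ker (factorRestrict U h)) :=
    (factorRestrict U h).quotKerEquivRange.symm.finiteDimensional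
  exact Module.Finite.of_submodule_quotient (LinearMap.ker (factorRestrict U h))

theorem relDim_add {U X Y : Submodule K V} (h : X ≤ Y) (hYU : Y ≤ U) (hU : U.RelFinite X) :
    U.relDim X = Y.relDim X + U.relDim Y := by
  have : FiniteDimensional K (U.map X.mkQ) := hU
  have := (factorRestrict U h).finrank_range_add_finrank_ker
  rw [range_factorRestrict, (kerFactorRestrictEquiv h hYU).finrank_eq] at this
  rw [relDim, relDim, relDim, ← this, add_comm]

/-- `U` and `X` are commensurable: `U ∩ X` has finite codimension in both. -/
def Commensurable (U X : Submodule K V) : Prop :=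
  U.RelFinite X ∧ X.RelFinite U

/-- The relative dimension `dim U / (U ∩ X) - dim X / (U ∩ X)`. -/
noncomputable def relIndex (U X : Submodule K V) : ℤ :=
  (U.relDim X : ℤ) - X.relDim U

theorem Commensurable.symm {U X : Submodule K V} (h : U.Commensurable X) : X.Commensurable U :=
  ⟨h.2, h.1⟩

theorem relIndex_symm (U X : Submodule K V) : X.relIndex U = -U.relIndex X := by
  simp [relIndex]

/-- Any common subspace of finite codimension can replace `U ∩ X`, because its codimension in `U ∩
X` cancels. This freedom gives additivity below. -/
theorem relIndex_eq_of_le {U X D : Submodule K V} (hU : D ≤ U) (hX : D ≤ X)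
    (hUD : U.RelFinite D) (hXD : X.RelFinite D) :
    U.relIndex X = (U.relDim D : ℤ) - X.relDim D := by
  have h1 := relDim_add (le_inf hU hX) inf_le_left hUD
  have h2 := relDim_add (le_inf hX hU) inf_le_left hXD
  rw [relDim_inf] at h1 h2
  rw [inf_comm X U] at h2
  rw [relIndex, h1, h2]
  push_cast
  ring

theorem RelFinite.inf_inf {U X Y : Submodule K V} (h1 : U.RelFinite X) (h2 : X.RelFinite Y) :
    U.RelFinite (U ⊓ X ⊓ Y) :=
  RelFinite.trans_of_le inf_le_left inf_le_left
    (relFinite_inf_iff.2 (h2.mono_left inf_le_right)) (relFinite_inf_iff.2 h1)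

theorem RelFinite.trans {U X Y : Submodule K V} (h1 : U.RelFinite X) (h2 : X.RelFinite Y) :
    U.RelFinite Y :=
  (h1.inf_inf h2).mono_right inf_le_right

theorem Commensurable.trans {U X Y : Submodule K V} (h1 : U.Commensurable X)
    (h2 : X.Commensurable Y) : U.Commensurable Y :=
  ⟨h1.1.trans h2.1, h2.2.trans h1.2⟩

/-- All three indices are computed against the triple intersection, and the sum telescopes. -/
theorem Commensurable.relIndex_add {U X Y : Submodule K V} (h1 : U.Commensurable X)
    (h2 : X.Commensurable Y) : U.relIndex X + X.relIndex Y = U.relIndex Y := by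
  have hU : U ⊓ X ⊓ Y ≤ U := inf_le_left.trans inf_le_left
  have hX : U ⊓ X ⊓ Y ≤ X := inf_le_left.trans inf_le_right
  have hY : U ⊓ X ⊓ Y ≤ Y := inf_le_right
  have fU : U.RelFinite (U ⊓ X ⊓ Y) := h1.1.inf_inf h2.1
  have fY : Y.RelFinite (U ⊓ X ⊓ Y) := by
    have := h2.2.inf_inf h1.2
    rwa [inf_comm Y X, inf_comm _ U, ← inf_assoc] at this
  have fX : X.RelFinite (U ⊓ X ⊓ Y) :=
    RelFinite.trans_of_le inf_le_left inf_le_right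
      (relFinite_inf_iff.2 ((h1.1.trans h2.1).mono_left inf_le_left))
      (by rw [inf_comm]; exact relFinite_inf_iff.2 h1.2)
  rw [relIndex_eq_of_le hU hX fU fX, relIndex_eq_of_le hX hY fX fY, relIndex_eq_of_le hU hY fU fY]
  ring

/-- For a linear map `f` and a subspace `X`, the quotient `V / (X + N(f))` is isomorphic to
`R(f) / f(X)`. -/
noncomputable def quotSupKerEquiv (f : V →ₗ[K] W) (X : Submodule K V) :
    (V ⧸ (X ⊔ LinearMap.ker f)) ≃ₗ[K] (LinearMap.range f).map (X.map f).mkQ :=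
  (Submodule.quotEquivOfEq _ _ (by
    rw [LinearMap.ker_comp, Submodule.ker_mkQ, Submodule.comap_map_eq])).trans
    (((X.map f).mkQ ∘ₗ f).quotKerEquivRange.trans (LinearEquiv.ofEq _ _ (LinearMap.range_comp _ _)))

theorem RelFinite.range_map {X : Submodule K V} (h : (⊤ : Submodule K V).RelFinite X)
    (f : V →ₗ[K] W) : (LinearMap.range f).RelFinite (X.map f) :=
  have := relFinite_top_iff.1 (h.mono_right (le_sup_left : X ≤ X ⊔ LinearMap.ker f))
  (quotSupKerEquiv f X).finiteDimensional

/-- Rank-nullity relative to a subspace of finite codimension. -/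
theorem relDim_ker_add_relDim_range {X : Submodule K V} (h : (⊤ : Submodule K V).RelFinite X)
    (f : V →ₗ[K] W) :
    (LinearMap.ker f).relDim X + (LinearMap.range f).relDim (X.map f) =
      (⊤ : Submodule K V).relDim X := by
  rw [relDim_add (le_sup_left : X ≤ X ⊔ LinearMap.ker f) le_top h, sup_comm X, relDim_sup,
    sup_comm _ X, relDim_top, (quotSupKerEquiv f X).finrank_eq]
  rfl

end Submodule

/-! ### Finite rank perturbations of a linear map -/

namespace LinearMap

variable {K V W : Type*} [Field K] [AddCommGroup V] [Module K V] [AddCommGroup W] [Module K W]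

open Submodule

theorem relFinite_top_ker_sub {f g : V →ₗ[K] W} (h : FiniteDimensional K (range (f - g))) :
    (⊤ : Submodule K V).RelFinite (ker (f - g)) :=
  relFinite_top_iff.2 (f - g).quotKerEquivRange.symm.finiteDimensional

theorem map_ker_sub (f g : V →ₗ[K] W) : (ker (f - g)).map f = (ker (f - g)).map g := by
  have h : ∀ x ∈ ker (f - g), f x = g x := fun x hx ↦ sub_eq_zero.1 (by simpa using hx)
  ext y
  exact ⟨fun ⟨x, hx, hy⟩ ↦ ⟨x, hx, (h x hx).symm.trans hy⟩,
    fun ⟨x, hx, hy⟩ ↦ ⟨x, hx, (h x hx).trans hy⟩⟩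

theorem ker_inf_ker_sub (f g : V →ₗ[K] W) : ker f ⊓ ker (f - g) = ker g ⊓ ker (f - g) := by
  ext x
  simp only [Submodule.mem_inf, mem_ker, sub_apply, sub_eq_zero]
  exact ⟨fun ⟨h1, h2⟩ ↦ ⟨h2 ▸ h1, h2⟩, fun ⟨h1, h2⟩ ↦ ⟨h2.trans h1, h2⟩⟩

/-- Both kernels meet `ker (f - g)`, which has finite codimension, in the same subspace. -/
theorem commensurable_ker {f g : V →ₗ[K] W} (h : FiniteDimensional K (range (f - g))) :
    (ker f).Commensurable (ker g) := by
  have hX := relFinite_top_ker_sub h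
  refine ⟨(relFinite_inf_iff.2 (hX.mono_left le_top)).mono_right ?_,
    (relFinite_inf_iff.2 (hX.mono_left le_top)).mono_right ?_⟩
  · exact (ker_inf_ker_sub f g).trans_le inf_le_left
  · exact (ker_inf_ker_sub f g).symm.trans_le inf_le_left

theorem commensurable_range {f g : V →ₗ[K] W} (h : FiniteDimensional K (range (f - g))) :
    (range f).Commensurable (range g) := by
  have hX := relFinite_top_ker_sub h
  refine ⟨(hX.range_map f).mono_right ?_, (hX.range_map g).mono_right ?_⟩
  · rw [map_ker_sub]
    exact map_le_range
  · rw [← map_ker_sub]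
    exact map_le_range

/-- A finite rank perturbation changes the kernel and the range by opposite amounts. -/
theorem relIndex_ker_add_relIndex_range {f g : V →ₗ[K] W}
    (h : FiniteDimensional K (range (f - g))) :
    (ker f).relIndex (ker g) + (range f).relIndex (range g) = 0 := by
  have hX := relFinite_top_ker_sub h
  -- With `X = ker (f - g)`, both maps satisfy `dim N/(N ∩ X) + dim R/f(X) = codim X`, with the same
  -- `N ∩ X` and the same `f(X) = g(X)`.
  have hf := relDim_ker_add_relDim_range hX f
  have hg := relDim_ker_add_relDim_range hX g
  have hg' := hX.range_map g
  rw [← map_ker_sub] at hg hg'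
  rw [← relDim_inf] at hf hg
  have hk : (ker g).RelFinite (ker f ⊓ ker (f - g)) := by
    rw [ker_inf_ker_sub]; exact relFinite_inf_iff.2 (hX.mono_left le_top)
  rw [relIndex_eq_of_le inf_le_left ((ker_inf_ker_sub f g).trans_le inf_le_left)
      (relFinite_inf_iff.2 (hX.mono_left le_top)) hk,
    relIndex_eq_of_le map_le_range ((map_ker_sub f g).trans_le map_le_range)
      (hX.range_map f) hg']
  rw [← ker_inf_ker_sub] at hg
  omega

end LinearMap

/-! ### Fredholm pairs as commensurable subspaces, and the pairs `(F, 0)` -/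

section

variable {𝕜 H₁ H₂ : Type*} [RCLike 𝕜]
  [NormedAddCommGroup H₁] [InnerProductSpace 𝕜 H₁]
  [NormedAddCommGroup H₂] [InnerProductSpace 𝕜 H₂]

open Submodule

theorem isFredholmPair_iff {S : H₁ →L[𝕜] H₂} {T : H₂ →L[𝕜] H₁} :
    IsFredholmPair S T ↔ S.ker.Commensurable T.range ∧ T.ker.Commensurable S.range := by
  have hb : T.range.RelFinite S.ker ↔ FiniteDimensional 𝕜 (RangeModKer S T) := by
    rw [relFinite_iff, inf_comm]
  have hd : S.range.RelFinite T.ker ↔ FiniteDimensional 𝕜 (RangeModKer T S) := by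
    rw [relFinite_iff, inf_comm]
  rw [Commensurable, Commensurable, hb, hd, relFinite_iff, relFinite_iff]
  exact ⟨fun h ↦ ⟨⟨h.finite_a, h.finite_b⟩, h.finite_c, h.finite_d⟩,
    fun h ↦ ⟨h.1.1, h.1.2, h.2.1, h.2.2⟩⟩

theorem fredholmPairIndex_eq_relIndex (S : H₁ →L[𝕜] H₂) (T : H₂ →L[𝕜] H₁) :
    fredholmPairIndex S T = S.ker.relIndex T.range - T.ker.relIndex S.range := by
  have hb : T.range.relDim S.ker = Module.finrank 𝕜 (RangeModKer S T) := by
    rw [relDim_eq, inf_comm]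
  have hd : S.range.relDim T.ker = Module.finrank 𝕜 (RangeModKer T S) := by
    rw [relDim_eq, inf_comm]
  rw [relIndex, relIndex, hb, hd, relDim_eq, relDim_eq, fredholmPairIndex]
  ring

/-- Fredholm pairs and their index are invariant under finite rank perturbations. -/
theorem IsFredholmPair.of_finiteDimensional_range_sub {S S' : H₁ →L[𝕜] H₂} {T T' : H₂ →L[𝕜] H₁}
    (h : IsFredholmPair S T) (hS : FiniteDimensional 𝕜 (S - S').range)
    (hT : FiniteDimensional 𝕜 (T - T').range) :
    IsFredholmPair S' T' ∧ fredholmPairIndex S T = fredholmPairIndex S' T' := by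
  obtain ⟨h1, h2⟩ := isFredholmPair_iff.1 h
  have kS : S.ker.Commensurable S'.ker := LinearMap.commensurable_ker hS
  have rS : S.range.Commensurable S'.range := LinearMap.commensurable_range hS
  have kT : T.ker.Commensurable T'.ker := LinearMap.commensurable_ker hT
  have rT : T.range.Commensurable T'.range := LinearMap.commensurable_range hT
  have eS : S.ker.relIndex S'.ker + S.range.relIndex S'.range = 0 :=
    LinearMap.relIndex_ker_add_relIndex_range hS
  have eT : T.ker.relIndex T'.ker + T.range.relIndex T'.range = 0 :=
    LinearMap.relIndex_ker_add_relIndex_range hT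
  refine ⟨isFredholmPair_iff.2 ⟨kS.symm.trans (h1.trans rT), kT.symm.trans (h2.trans rS)⟩, ?_⟩
  -- The new index is expanded along `N(S'), N(S), R(T), R(T')` and `N(T'), N(T), R(S), R(S')`; the
  -- corrections cancel by `eS` and `eT`.
  rw [fredholmPairIndex_eq_relIndex, fredholmPairIndex_eq_relIndex,
    ← kS.symm.relIndex_add (h1.trans rT), ← kT.symm.relIndex_add (h2.trans rS),
    ← h1.relIndex_add rT, ← h2.relIndex_add rS, relIndex_symm S.ker, relIndex_symm T.ker]
  omega

/-- `S` factors through `H₁/N(S)`, where the image of `R(T)` is finite dimensional. -/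
theorem IsFredholmPair.finiteDimensional_range_comp {S : H₁ →L[𝕜] H₂} {T : H₂ →L[𝕜] H₁}
    (h : IsFredholmPair S T) : FiniteDimensional 𝕜 (S ∘L T).range := by
  have hfin := (isFredholmPair_iff.1 h).1.2
  have : FiniteDimensional 𝕜 (T.range.map S.ker.mkQ) := hfin
  have hr : (S ∘L T).range =
      (T.range.map S.ker.mkQ).map (S.ker.liftQ S.toLinearMap le_rfl) := by
    rw [← Submodule.map_comp, Submodule.liftQ_mkQ]
    exact LinearMap.range_comp _ _
  rw [hr]
  infer_instance

theorem IsFredholmPair.swap {S : H₁ →L[𝕜] H₂} {T : H₂ →L[𝕜] H₁} (h : IsFredholmPair S T) :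
    IsFredholmPair T S :=
  ⟨h.finite_c, h.finite_d, h.finite_a, h.finite_b⟩

theorem ContinuousLinearMap.finiteDimensional_range_sub_comm {A B : H₁ →L[𝕜] H₂}
    (h : FiniteDimensional 𝕜 (A - B).range) : FiniteDimensional 𝕜 (B - A).range := by
  have : (B - A).range = (A - B).range := by
    rw [← neg_sub A B]
    exact LinearMap.range_neg _
  rwa [this]

/-- `(F, 0)` is a Fredholm pair if and only if `F` has finite dimensional kernel and cokernel. -/
theorem isFredholmPair_zero_iff {F : H₁ →L[𝕜] H₂} :
    IsFredholmPair F 0 ↔ F.ker.RelFinite ⊥ ∧ (⊤ : Submodule 𝕜 H₂).RelFinite F.range := by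
  have hk : (0 : H₂ →L[𝕜] H₁).ker = ⊤ := LinearMap.ker_zero
  have hr : (0 : H₂ →L[𝕜] H₁).range = ⊥ := LinearMap.range_zero
  rw [isFredholmPair_iff, hk, hr]
  exact ⟨fun h ↦ ⟨h.1.1, h.2.1⟩, fun h ↦ ⟨⟨h.1, RelFinite.of_le bot_le⟩, h.2, RelFinite.of_le le_top⟩⟩

theorem fredholmPairIndex_zero (F : H₁ →L[𝕜] H₂) :
    fredholmPairIndex F 0 = (F.ker.relDim ⊥ : ℤ) - (⊤ : Submodule 𝕜 H₂).relDim F.range := by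
  have hk : (0 : H₂ →L[𝕜] H₁).ker = ⊤ := LinearMap.ker_zero
  have hr : (0 : H₂ →L[𝕜] H₁).range = ⊥ := LinearMap.range_zero
  rw [fredholmPairIndex_eq_relIndex, hk, hr, relIndex, relIndex, relDim_eq_zero_of_le bot_le,
    relDim_eq_zero_of_le le_top]
  simp

/-- If `E` has finite codimension, `F` is injective on `E` and `M` is a finite dimensional
complement of `F(E)`, then `F` is Fredholm of index `codim E - dim M`. -/
theorem isFredholmPair_zero_of_isCompl {F : H₁ →L[𝕜] H₂} {E : Submodule 𝕜 H₁} {M : Submodule 𝕜 H₂}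
    (hE : (⊤ : Submodule 𝕜 H₁).RelFinite E) (hM : FiniteDimensional 𝕜 M)
    (hker : Disjoint F.ker E) (hc : IsCompl (E.map F.toLinearMap) M) :
    IsFredholmPair F 0 ∧
      fredholmPairIndex F 0 = ((⊤ : Submodule 𝕜 H₁).relDim E : ℤ) - Module.finrank 𝕜 M := by
  have hle : E.map F.toLinearMap ≤ F.range := LinearMap.map_le_range
  have e := Submodule.quotientEquivOfIsCompl _ _ hc
  have hcod : (⊤ : Submodule 𝕜 H₂).RelFinite (E.map F.toLinearMap) :=
    relFinite_top_iff.2 e.symm.finiteDimensional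
  -- `dim R(F)/F(E)` appears both in `codim E` and in `dim M = codim F(E)`, and drops out of the
  -- difference.
  have h1 := relDim_ker_add_relDim_range hE F.toLinearMap
  have h2 := relDim_add hle le_top hcod
  rw [relDim_top, e.finrank_eq] at h2
  have h3 : F.ker.RelFinite ⊥ := by
    rw [← hker.eq_bot]; exact relFinite_inf_iff.2 (hE.mono_left le_top)
  rw [← relDim_inf, hker.eq_bot] at h1
  refine ⟨isFredholmPair_zero_iff.2 ⟨h3, hcod.mono_right hle⟩, ?_⟩
  rw [fredholmPairIndex_zero]
  omega

/-! ### Stability of Fredholm operators -/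

variable [CompleteSpace H₁]

theorem ContinuousLinearMap.range_comp_subtypeL_orthogonal_ker (A : H₁ →L[𝕜] H₂) :
    (A ∘L A.kerᗮ.subtypeL).range = A.range := by
  refine le_antisymm (LinearMap.range_comp_le_range _ _) ?_
  rintro _ ⟨x, rfl⟩
  have hx : x ∈ A.ker ⊔ A.kerᗮ := A.ker.isCompl_orthogonal.sup_eq_top ▸ mem_top
  obtain ⟨u, hu, v, hv, rfl⟩ := Submodule.mem_sup.1 hx
  have hu' : A u = 0 := hu
  exact ⟨⟨v, hv⟩, by simp [hu']⟩

variable [CompleteSpace H₂]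

/-- The Fredholm property and the index are stable under small perturbations. -/
theorem IsFredholmPair.exists_stable_of_zero {F : H₁ →L[𝕜] H₂} (hF : IsFredholmPair F 0) :
    ∃ ε : ℝ, 0 < ε ∧ ∀ F₁ : H₁ →L[𝕜] H₂, ‖F - F₁‖ < ε →
      IsFredholmPair F₁ 0 ∧ fredholmPairIndex F 0 = fredholmPairIndex F₁ 0 := by
  obtain ⟨h1, h2⟩ := isFredholmPair_zero_iff.1 hF
  have := relFinite_bot_iff.1 h1
  have := relFinite_top_iff.1 h2
  obtain ⟨M, hM⟩ := F.range.exists_isCompl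
  have eM := Submodule.quotientEquivOfIsCompl _ _ hM
  have : FiniteDimensional 𝕜 M := eM.finiteDimensional
  have : CompleteSpace M := FiniteDimensional.complete 𝕜 M
  have : CompleteSpace F.ker := FiniteDimensional.complete 𝕜 F.ker
  let E := F.kerᗮ
  have hEc : IsCompl E F.ker := F.ker.isCompl_orthogonal.symm
  have hE : (⊤ : Submodule 𝕜 H₁).RelFinite E :=
    relFinite_top_iff.2 (Submodule.quotientEquivOfIsCompl _ _ hEc).symm.finiteDimensional
  -- `Φ G (x, m) = G x + m`. Its invertibility is an open condition on `G` and forces `G` to have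
  -- index `codim E - dim M`, where `E` and `M` do not depend on `G`.
  let Φ : (H₁ →L[𝕜] H₂) → (E × M →L[𝕜] H₂) := fun G ↦ (G ∘L E.subtypeL).coprod M.subtypeL
  have hΦ : Continuous Φ := by
    have : Φ = fun G ↦ (G ∘L E.subtypeL) ∘L ContinuousLinearMap.fst 𝕜 E M +
        M.subtypeL ∘L ContinuousLinearMap.snd 𝕜 E M := by
      ext G x <;> simp [Φ]
    rw [this]
    fun_prop
  have key : ∀ G : H₁ →L[𝕜] H₂, Function.Bijective (Φ G) →
      Disjoint G.ker E ∧ IsCompl (E.map G.toLinearMap) M := by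
    intro G hG
    refine ⟨?_, ?_, ?_⟩
    · rw [Submodule.disjoint_def]
      intro x hx hxE
      have : ((⟨x, hxE⟩ : E), (0 : M)) = 0 := hG.1 (by simpa [Φ] using hx)
      simpa using this
    · rw [Submodule.disjoint_def]
      rintro _ ⟨x, hx, rfl⟩ hxM
      have : ((⟨x, hx⟩ : E), -(⟨G x, hxM⟩ : M)) = 0 := hG.1 (by simp [Φ])
      simpa using congrArg Prod.snd this
    · rw [codisjoint_iff, eq_top_iff]
      intro y _
      obtain ⟨⟨x, m⟩, rfl⟩ := hG.2 y
      exact Submodule.add_mem_sup ⟨x, x.2, rfl⟩ m.2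
  have hbij : Function.Bijective (Φ F) := by
    constructor
    · rw [injective_iff_map_eq_zero]
      rintro ⟨x, m⟩ hx
      have hx' : F x + m = 0 := by simpa [Φ] using hx
      have hm : (m : H₂) = 0 := Submodule.disjoint_def.1 hM.disjoint _
        ⟨-x, by simpa using (eq_neg_of_add_eq_zero_right hx').symm⟩ m.2
      have hx0 : (x : H₁) = 0 := Submodule.disjoint_def.1 hEc.disjoint _ x.2
        (by simpa [hm] using hx')
      ext <;> simp [hm, hx0]
    · intro y
      have hy : y ∈ F.range ⊔ M := hM.sup_eq_top ▸ Submodule.mem_top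
      obtain ⟨_, ⟨x, rfl⟩, m, hm, rfl⟩ := Submodule.mem_sup.1 hy
      have hx : x ∈ E ⊔ F.ker := hEc.sup_eq_top ▸ Submodule.mem_top
      obtain ⟨u, hu, v, hv, rfl⟩ := Submodule.mem_sup.1 hx
      have hv' : F v = 0 := hv
      exact ⟨(⟨u, hu⟩, ⟨m, hm⟩), by simp [Φ, hv']⟩
  have hopen : IsOpen (Φ ⁻¹' Set.range ((↑) : ((E × M) ≃L[𝕜] H₂) → (E × M →L[𝕜] H₂))) :=
    (ContinuousLinearEquiv.isOpen).preimage hΦ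
  have hmem : F ∈ Φ ⁻¹' Set.range ((↑) : ((E × M) ≃L[𝕜] H₂) → (E × M →L[𝕜] H₂)) :=
    ⟨ContinuousLinearEquiv.ofBijective (Φ F) (LinearMap.ker_eq_bot.2 hbij.1)
      (LinearMap.range_eq_top.2 hbij.2), ContinuousLinearEquiv.coe_ofBijective _ _ _⟩
  obtain ⟨ε, hε, hball⟩ := Metric.isOpen_iff.1 hopen F hmem
  obtain ⟨k0, c0⟩ := key F hbij
  refine ⟨ε, hε, fun F₁ hF₁ ↦ ?_⟩
  obtain ⟨e, he⟩ := hball (show F₁ ∈ Metric.ball F ε by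
    rwa [Metric.mem_ball, dist_comm, dist_eq_norm])
  obtain ⟨k1, c1⟩ := key F₁ (by rw [← he]; exact e.bijective)
  have i0 := isFredholmPair_zero_of_isCompl hE inferInstance k0 c0
  have i1 := isFredholmPair_zero_of_isCompl hE inferInstance k1 c1
  exact ⟨i1.1, i0.2.trans i1.2.symm⟩

end

/-! ### Closed ranges and adjoints -/

section

variable {𝕜 H₁ H₂ : Type*} [RCLike 𝕜]
  [NormedAddCommGroup H₁] [InnerProductSpace 𝕜 H₁] [CompleteSpace H₁]
  [NormedAddCommGroup H₂] [InnerProductSpace 𝕜 H₂] [CompleteSpace H₂]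

open Submodule
open scoped InnerProduct

namespace ContinuousLinearMap

/-- An operator whose range has finite codimension has closed range. -/
theorem isClosed_range_of_relFinite {A : H₁ →L[𝕜] H₂}
    (h : (⊤ : Submodule 𝕜 H₂).RelFinite A.range) : IsClosed (A.range : Set H₂) := by
  have := relFinite_top_iff.1 h
  obtain ⟨M, hM⟩ := A.range.exists_isCompl
  have : FiniteDimensional 𝕜 M := (Submodule.quotientEquivOfIsCompl _ _ hM).finiteDimensional
  have hr := A.range_comp_subtypeL_orthogonal_ker
  have hk : (A ∘L A.kerᗮ.subtypeL).ker = ⊥ := by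
    rw [eq_bot_iff]
    intro x hx
    have := Submodule.disjoint_def.1 A.ker.isCompl_orthogonal.disjoint (x : H₁) hx x.2
    simpa using this
  rw [← hr] at hM ⊢
  exact closed_complemented_range_of_isCompl_of_ker_eq_bot _ M hM M.closed_of_finiteDimensional hk

/-- An operator whose range has finite codimension in a closed subspace has closed range. -/
theorem isClosed_range_of_relFinite_of_le {A : H₁ →L[𝕜] H₂} {N : Submodule 𝕜 H₂}
    (hN : IsClosed (N : Set H₂)) (hle : A.range ≤ N) (h : N.RelFinite A.range) :
    IsClosed (A.range : Set H₂) := by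
  have : CompleteSpace N := hN.completeSpace_coe
  let B : H₁ →L[𝕜] N := A.codRestrict N fun x ↦ hle ⟨x, rfl⟩
  have hB : B.range = A.range.submoduleOf N := by
    ext ⟨y, hy⟩
    simp [B, Submodule.submoduleOf, Subtype.ext_iff]
  have hfin : (⊤ : Submodule 𝕜 N).RelFinite B.range := by
    rw [relFinite_iff, inf_eq_right.2 hle] at h
    rw [relFinite_top_iff, hB]
    exact h
  have hAB : A.range = B.range.map N.subtype := by
    rw [hB, Submodule.submoduleOf, Submodule.map_comap_subtype, inf_eq_right.2 hle]
  rw [hAB, Submodule.map_coe]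
  exact hN.isClosedEmbedding_subtypeVal.isClosedMap _ (isClosed_range_of_relFinite hfin)

theorem range_sup_ker_adjoint_eq_top_of_isClosed {A : H₁ →L[𝕜] H₂}
    (h : IsClosed (A.range : Set H₂)) : A.range ⊔ A†.ker = ⊤ := by
  have : CompleteSpace A.range := h.completeSpace_coe
  rw [← A.orthogonal_range]
  exact A.range.isCompl_orthogonal.sup_eq_top

/-- If the range of `A†` is the orthogonal complement of the kernel of `A`, then the kernel of `A†`
complements the range of `A`. -/
theorem range_sup_ker_adjoint_eq_top {A : H₁ →L[𝕜] H₂} (h : A.ker ⊔ A†.range = ⊤) :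
    A.range ⊔ A†.ker = ⊤ := by
  have hle : ∀ y, (A†) y ∈ A.kerᗮ := fun y ↦ by
    rw [A.orthogonal_ker]
    exact Submodule.le_topologicalClosure _ ⟨y, rfl⟩
  let B : H₂ →L[𝕜] A.kerᗮ := (A†).codRestrict _ hle
  have hB : Function.Surjective B := by
    rintro ⟨x, hx⟩
    have hx' : x ∈ A.ker ⊔ A†.range := h ▸ mem_top
    obtain ⟨u, hu, _, ⟨y, rfl⟩, hsum⟩ := Submodule.mem_sup.1 hx'
    have hu0 : u = 0 := by
      refine Submodule.disjoint_def.1 A.ker.isCompl_orthogonal.disjoint u hu ?_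
      rw [eq_sub_of_add_eq hsum]
      exact sub_mem hx (hle y)
    refine ⟨y, Subtype.ext ?_⟩
    simpa [B, hu0] using hsum
  -- The open mapping theorem bounds preimages under `A†`; pairing `x = A† y` with itself gives
  -- `‖x‖² = ⟨A x, y⟩ ≤ C ‖A x‖ ‖x‖`, so `A` is bounded below on `N(A)ᗮ`.
  obtain ⟨C, hC, hpre⟩ := B.exists_preimage_norm_le hB
  let R : A.kerᗮ →L[𝕜] H₂ := A ∘L A.kerᗮ.subtypeL
  have hR : AntilipschitzWith ⟨C, hC.le⟩ R := by
    refine ContinuousLinearMap.antilipschitz_of_bound _ fun x ↦ ?_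
    obtain ⟨y, rfl, hy⟩ := hpre x
    change ‖B y‖ ≤ C * ‖R (B y)‖
    rcases (norm_nonneg (B y)).eq_or_lt with h0 | h0
    · rw [← h0]; positivity
    have h1 : ‖B y‖ * ‖B y‖ ≤ ‖R (B y)‖ * ‖y‖ := by
      have : inner 𝕜 (B y) (B y) = inner 𝕜 (R (B y)) y :=
        A.adjoint_inner_right (B y : H₁) y
      calc ‖B y‖ * ‖B y‖ = ‖inner 𝕜 (B y) (B y)‖ := by
            rw [inner_self_eq_norm_sq_to_K]; simp [sq]
        _ ≤ _ := by rw [this]; exact norm_inner_le_norm _ _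
    have h2 : ‖B y‖ * ‖B y‖ ≤ (C * ‖R (B y)‖) * ‖B y‖ :=
      h1.trans ((mul_le_mul_of_nonneg_left hy (norm_nonneg _)).trans_eq (by ring))
    exact le_of_mul_le_mul_right h2 h0
  refine range_sup_ker_adjoint_eq_top_of_isClosed ?_
  rw [← A.range_comp_subtypeL_orthogonal_ker]
  exact hR.isClosed_range R.uniformContinuous

theorem ker_sup_range_adjoint_eq_top {A : H₁ →L[𝕜] H₂} (h : A.range ⊔ A†.ker = ⊤) :
    A.ker ⊔ A†.range = ⊤ := by
  have := range_sup_ker_adjoint_eq_top (A := A†) (by rwa [adjoint_adjoint, sup_comm])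
  rwa [adjoint_adjoint, sup_comm] at this

/-- The adjoint of a finite rank operator has finite rank. -/
theorem finiteDimensional_range_adjoint {A : H₁ →L[𝕜] H₂} (h : FiniteDimensional 𝕜 A.range) :
    FiniteDimensional 𝕜 (A†).range := by
  have : CompleteSpace A.range := FiniteDimensional.complete 𝕜 _
  have hle : A†.range ≤ A.range.map (A†).toLinearMap := by
    rintro _ ⟨y, rfl⟩
    have hy : y ∈ A.range ⊔ A.rangeᗮ := A.range.isCompl_orthogonal.sup_eq_top ▸ mem_top
    obtain ⟨u, hu, v, hv, rfl⟩ := Submodule.mem_sup.1 hy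
    rw [A.orthogonal_range] at hv
    have hv' : (A†) v = 0 := hv
    exact ⟨u, hu, by simp [hv']⟩
  exact Submodule.finiteDimensional_of_le hle

end ContinuousLinearMap

open ContinuousLinearMap

/-! ### Hodge decomposition of a two-periodic complex -/

section Complex

variable {S : H₁ →L[𝕜] H₂} {T : H₂ →L[𝕜] H₁}

/-- Applying `T` leaves `T T† x = 0`, and `N(T T†) = N(T†)`. -/
theorem adjoint_apply_eq_zero_of_add (hTS : T ∘L S = 0) {x : H₁} {y : H₂}
    (hy : T y = 0) (hx : (S + T†) x = y) : (T†) x = 0 := by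
  have h1 : T ((T†) x) = 0 := by
    have h2 : T (S x) = 0 := congrArg (fun f : H₁ →L[𝕜] H₁ ↦ f x) hTS
    have h3 := congrArg T hx
    rw [hy, add_apply, map_add, h2, zero_add] at h3
    exact h3
  have h4 : x ∈ (T ∘L T†).ker := h1
  rwa [T.ker_self_comp_adjoint] at h4

theorem ker_add_adjoint (hTS : T ∘L S = 0) : (S + T†).ker = S.ker ⊓ T†.ker := by
  ext x
  constructor
  · intro hx
    have hx' : (S + T†) x = 0 := hx
    have h := adjoint_apply_eq_zero_of_add hTS (map_zero T) hx'
    rw [add_apply, h, add_zero] at hx'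
    exact ⟨hx', h⟩
  · rintro ⟨h1, h2⟩
    have h1' : S x = 0 := h1
    have h2' : (T†) x = 0 := h2
    change (S + T†) x = 0
    rw [add_apply, h1', h2', add_zero]

theorem ker_inf_range_add_adjoint (hST : S ∘L T = 0) (hTS : T ∘L S = 0)
    (h : T.range ⊔ T†.ker = ⊤) : T.ker ⊓ (S + T†).range = S.range := by
  ext y
  constructor
  · rintro ⟨hy, x, hx⟩
    have hx' : (S + T†) x = y := hx
    have h := adjoint_apply_eq_zero_of_add hTS hy hx'
    exact ⟨x, by simpa [h] using hx'⟩
  · rintro ⟨x, rfl⟩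
    refine ⟨congrArg (fun f : H₁ →L[𝕜] H₁ ↦ f x) hTS, ?_⟩
    have hx : x ∈ T.range ⊔ T†.ker := h ▸ mem_top
    obtain ⟨_, ⟨u, rfl⟩, v, hv, rfl⟩ := Submodule.mem_sup.1 hx
    have h1 : S (T u) = 0 := congrArg (fun f : H₂ →L[𝕜] H₂ ↦ f u) hST
    have h2 : (T†) v = 0 := hv
    -- Dropping the component in `R(T)` does not change the value of `S` and makes `T†` vanish.
    exact ⟨v, by simp [h1, h2]⟩

theorem range_adjoint_le_range_add_adjoint (hST : S ∘L T = 0) (h : T.range ⊔ T†.ker = ⊤) :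
    T†.range ≤ (S + T†).range := by
  rintro _ ⟨x, rfl⟩
  have hx : x ∈ T.range ⊔ T†.ker := h ▸ mem_top
  obtain ⟨_, ⟨u, rfl⟩, v, hv, rfl⟩ := Submodule.mem_sup.1 hx
  have h1 : S (T u) = 0 := congrArg (fun f : H₂ →L[𝕜] H₂ ↦ f u) hST
  have h2 : (T†) v = 0 := hv
  exact ⟨T u, by simp [h1, h2]⟩

theorem ker_add_adjoint_sup_range (hST : S ∘L T = 0) (hTS : T ∘L S = 0)
    (h : T.range ⊔ T†.ker = ⊤) : (S + T†).ker ⊔ T.range = S.ker := by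
  have hle : T.range ≤ S.ker := by
    rintro _ ⟨u, rfl⟩
    exact congrArg (fun f : H₂ →L[𝕜] H₂ ↦ f u) hST
  rw [ker_add_adjoint hTS]
  refine le_antisymm (sup_le inf_le_left hle) fun x hx ↦ ?_
  have hx' : x ∈ T.range ⊔ T†.ker := h ▸ mem_top
  obtain ⟨u, hu, v, hv, rfl⟩ := Submodule.mem_sup.1 hx'
  rw [add_comm]
  exact Submodule.add_mem_sup ⟨(Submodule.add_mem_iff_right _ (hle hu)).1 hx, hv⟩ hu

theorem ker_add_adjoint_inf_range (hTS : T ∘L S = 0) : (S + T†).ker ⊓ T.range = ⊥ := by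
  rw [ker_add_adjoint hTS, ← T.orthogonal_range, inf_assoc, inf_comm _ T.range,
    T.range.inf_orthogonal_eq_bot, inf_bot_eq]

/-- For a two-periodic complex `(S, T)` in which `T` has closed range, `(S, T)` is a Fredholm pair
if and only if `S + T†` is a Fredholm operator, and the indices agree. -/
theorem isFredholmPair_iff_add_adjoint_of_sup_eq_top (hST : S ∘L T = 0) (hTS : T ∘L S = 0)
    (h : T.range ⊔ T†.ker = ⊤) :
    (IsFredholmPair S T ↔ IsFredholmPair (S + T†) 0) ∧
      fredholmPairIndex S T = fredholmPairIndex (S + T†) 0 := by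
  have hTle : T.range ≤ S.ker := by
    rintro _ ⟨u, rfl⟩
    exact congrArg (fun f : H₂ →L[𝕜] H₂ ↦ f u) hST
  have hSle : S.range ≤ T.ker := by
    rintro _ ⟨u, rfl⟩
    exact congrArg (fun f : H₁ →L[𝕜] H₁ ↦ f u) hTS
  -- Hence the cokernel of `S + T†` is `N(T)` modulo `N(T) ∩ R(S + T†) = R(S)`.
  have htop : T.ker ⊔ (S + T†).range = ⊤ :=
    eq_top_iff.2 ((ker_sup_range_adjoint_eq_top h).symm.trans_le
      (sup_le_sup_left (range_adjoint_le_range_add_adjoint hST h) _))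
  have ha : S.ker.RelFinite T.range ↔ (S + T†).ker.RelFinite ⊥ := by
    rw [← ker_add_adjoint_sup_range hST hTS h, relFinite_sup_iff, ← relFinite_inf_iff,
      ker_add_adjoint_inf_range hTS]
  have ha' : S.ker.relDim T.range = (S + T†).ker.relDim ⊥ := by
    rw [← ker_add_adjoint_sup_range hST hTS h, relDim_sup, ← relDim_inf,
      ker_add_adjoint_inf_range hTS]
  have hc : T.ker.RelFinite S.range ↔ (⊤ : Submodule 𝕜 H₂).RelFinite (S + T†).range := by
    rw [← htop, relFinite_sup_iff, ← relFinite_inf_iff (X := (S + T†).range),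
      ker_inf_range_add_adjoint hST hTS h]
  have hc' : T.ker.relDim S.range = (⊤ : Submodule 𝕜 H₂).relDim (S + T†).range := by
    rw [← htop, relDim_sup, ← relDim_inf _ (S + T†).range, ker_inf_range_add_adjoint hST hTS h]
  constructor
  · rw [isFredholmPair_iff, isFredholmPair_zero_iff, ← ha, ← hc]
    exact ⟨fun h ↦ ⟨h.1.1, h.2.1⟩, fun h ↦ ⟨⟨h.1, RelFinite.of_le hTle⟩, h.2, RelFinite.of_le hSle⟩⟩
  · rw [fredholmPairIndex_eq_relIndex, fredholmPairIndex_zero, relIndex, relIndex, relDim_eq_zero_of_le hTle,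
      relDim_eq_zero_of_le hSle, ha', hc']
    simp

/-- For a two-periodic complex `(S, T)`, `(S, T)` is a Fredholm pair if and only if `S + T†` is a
Fredholm operator, and then the indices agree. -/
theorem isFredholmPair_iff_add_adjoint (hST : S ∘L T = 0) (hTS : T ∘L S = 0) :
    (IsFredholmPair S T ↔ IsFredholmPair (S + T†) 0) ∧
      (IsFredholmPair S T → fredholmPairIndex S T = fredholmPairIndex (S + T†) 0) := by
  have h1 : IsFredholmPair S T → T.range ⊔ T†.ker = ⊤ := by
    intro h
    refine range_sup_ker_adjoint_eq_top_of_isClosed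
      (isClosed_range_of_relFinite_of_le S.isClosed_ker ?_ (isFredholmPair_iff.1 h).1.1)
    rintro _ ⟨u, rfl⟩
    exact congrArg (fun f : H₂ →L[𝕜] H₂ ↦ f u) hST
  -- `N(T) + R(T†)` contains the closed, finite codimensional `R(S + T†)`, so it is closed; its
  -- orthogonal complement is zero.
  have h2 : IsFredholmPair (S + T†) 0 → T.range ⊔ T†.ker = ⊤ := by
    intro h
    have hfin := (isFredholmPair_zero_iff.1 h).2
    have := relFinite_top_iff.1 hfin
    have hle : (S + T†).range ≤ T.ker ⊔ T†.range := by
      rintro _ ⟨x, rfl⟩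
      exact Submodule.add_mem_sup (congrArg (fun f : H₁ →L[𝕜] H₁ ↦ f x) hTS) ⟨x, rfl⟩
    have hcl := Submodule.isClosed_mono_of_finiteDimensional_quotient
      (isClosed_range_of_relFinite hfin) hle
    refine range_sup_ker_adjoint_eq_top ?_
    rw [← hcl.submodule_topologicalClosure_eq, Submodule.topologicalClosure_eq_top_iff,
      ← Submodule.inf_orthogonal, (T†).orthogonal_range, adjoint_adjoint, inf_comm,
      T.ker.inf_orthogonal_eq_bot]
  exact ⟨⟨fun h ↦ (isFredholmPair_iff_add_adjoint_of_sup_eq_top hST hTS (h1 h)).1.1 h,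
    fun h ↦ (isFredholmPair_iff_add_adjoint_of_sup_eq_top hST hTS (h2 h)).1.2 h⟩,
    fun h ↦ (isFredholmPair_iff_add_adjoint_of_sup_eq_top hST hTS (h1 h)).2⟩

end Complex

/-! ### From finite rank products to complexes -/

/-- For `A` of finite rank there is a projection `P` onto the kernel of `A` such that `S ∘L P` is a
finite rank perturbation of `S`. -/
theorem exists_comp_eq_zero {E F G : Type*} [NormedAddCommGroup E] [InnerProductSpace 𝕜 E]
    [CompleteSpace E] [NormedAddCommGroup F] [InnerProductSpace 𝕜 F] [NormedAddCommGroup G]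
    [InnerProductSpace 𝕜 G]
    (S : E →L[𝕜] F) (A : E →L[𝕜] G) (hA : FiniteDimensional 𝕜 A.range) :
    ∃ P : E →L[𝕜] E, A ∘L P = 0 ∧ (∀ x, A x = 0 → P x = x) ∧
      FiniteDimensional 𝕜 (S - S ∘L P).range := by
  have : FiniteDimensional 𝕜 (E ⧸ A.ker) := A.toLinearMap.quotKerEquivRange.symm.finiteDimensional
  refine ⟨A.ker.starProjection, ?_, ?_, ?_⟩
  · ext x
    exact A.ker.starProjection_apply_mem x
  · exact fun x hx ↦ Submodule.starProjection_eq_self_iff.2 hx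
  · have hle : A.ker ≤ (S - S ∘L A.ker.starProjection).ker := by
      intro x hx
      have := Submodule.starProjection_eq_self_iff.2 hx
      simp [this]
    have : FiniteDimensional 𝕜 (E ⧸ (S - S ∘L A.ker.starProjection).ker) :=
      relFinite_top_iff.1 ((relFinite_top_iff.2 this).mono_right hle)
    exact (S - S ∘L A.ker.starProjection).toLinearMap.quotKerEquivRange.finiteDimensional

/-- A pair whose two products have finite rank is a finite rank perturbation of a complex. -/
theorem exists_complex_of_finiteDimensional_range {S : H₁ →L[𝕜] H₂} {T : H₂ →L[𝕜] H₁}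
    (hTS : FiniteDimensional 𝕜 (T ∘L S).range) (hST : FiniteDimensional 𝕜 (S ∘L T).range) :
    ∃ (S' : H₁ →L[𝕜] H₂) (T' : H₂ →L[𝕜] H₁), S' ∘L T' = 0 ∧ T' ∘L S' = 0 ∧
      FiniteDimensional 𝕜 (S - S').range ∧ FiniteDimensional 𝕜 (T - T').range := by
  obtain ⟨P, hP, -, hSP⟩ := exists_comp_eq_zero S (T ∘L S) hTS
  have hfin : FiniteDimensional 𝕜 ((S ∘L P) ∘L T).range := by
    have hle : ((S ∘L P) ∘L T).range ≤ (S ∘L T).range ⊔ (S - S ∘L P).range := by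
      rintro _ ⟨y, rfl⟩
      have : ((S ∘L P) ∘L T) y = (S ∘L T) y + (S - S ∘L P) (-(T y)) := by simp
      rw [coe_coe, this]
      exact Submodule.add_mem_sup ⟨y, rfl⟩ ⟨_, rfl⟩
    exact Submodule.finiteDimensional_of_le hle
  obtain ⟨Q, hQ, hQid, hTQ⟩ := exists_comp_eq_zero T ((S ∘L P) ∘L T) hfin
  have hTSP : ∀ x, T (S (P x)) = 0 := fun x ↦ congrArg (fun f : H₁ →L[𝕜] H₁ ↦ f x) hP
  refine ⟨S ∘L P, T ∘L Q, hQ, ?_, hSP, hTQ⟩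
  ext x
  -- `TSP = 0` puts `R(SP)` inside `N(SPT)`, which `Q` fixes; so correcting `T` preserves the first
  -- relation.
  have : Q (S (P x)) = S (P x) := hQid _ (by simp [hTSP])
  simp [this, hTSP]

/-- For operators `S` and `T` whose products have finite rank, `(S, T)` is a Fredholm pair if and
only if `S + T†` is a Fredholm operator, and then the indices agree. -/
theorem isFredholmPair_iff_add_adjoint_of_finiteDimensional_range
    {S : H₁ →L[𝕜] H₂} {T : H₂ →L[𝕜] H₁}
    (hTS : FiniteDimensional 𝕜 (T ∘L S).range) (hST : FiniteDimensional 𝕜 (S ∘L T).range) :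
    (IsFredholmPair S T ↔ IsFredholmPair (S + T†) 0) ∧
      (IsFredholmPair S T → fredholmPairIndex S T = fredholmPairIndex (S + T†) 0) := by
  obtain ⟨S', T', hST', hTS', hS, hT⟩ := exists_complex_of_finiteDimensional_range hTS hST
  have h0 : FiniteDimensional 𝕜 (0 - 0 : H₂ →L[𝕜] H₁).range := by
    have : (0 - 0 : H₂ →L[𝕜] H₁).range = ⊥ := by
      rw [sub_zero]; exact LinearMap.range_zero
    rw [this]; infer_instance
  have hF : FiniteDimensional 𝕜 ((S + T†) - (S' + T'†)).range := by
    have := finiteDimensional_range_adjoint hT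
    have hle : ((S + T†) - (S' + T'†)).range ≤ (S - S').range ⊔ ((T - T')†).range := by
      rintro _ ⟨x, rfl⟩
      have : ((S + T†) - (S' + T'†)) x = (S - S') x + ((T - T')†) x := by
        simp [map_sub]; abel
      rw [coe_coe, this]
      exact Submodule.add_mem_sup ⟨x, rfl⟩ ⟨x, rfl⟩
    exact Submodule.finiteDimensional_of_le hle
  obtain ⟨hiff, hind⟩ := isFredholmPair_iff_add_adjoint hST' hTS'
  refine ⟨⟨fun h ↦ ?_, fun h ↦ ?_⟩, fun h ↦ ?_⟩
  · exact ((hiff.1 (h.of_finiteDimensional_range_sub hS hT).1).of_finiteDimensional_range_sub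
      (finiteDimensional_range_sub_comm hF) h0).1
  · exact ((hiff.2 (h.of_finiteDimensional_range_sub hF h0).1).of_finiteDimensional_range_sub
      (finiteDimensional_range_sub_comm hS) (finiteDimensional_range_sub_comm hT)).1
  · obtain ⟨h', e⟩ := h.of_finiteDimensional_range_sub hS hT
    rw [e, hind h']
    exact ((hiff.1 h').of_finiteDimensional_range_sub (finiteDimensional_range_sub_comm hF) h0).2

end

/-! ### The stability theorem -/

theorem theorem5p1 {𝕜 H₁ H₂ : Type*} [RCLike 𝕜]
    [NormedAddCommGroup H₁] [InnerProductSpace 𝕜 H₁] [CompleteSpace H₁]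
    [NormedAddCommGroup H₂] [InnerProductSpace 𝕜 H₂] [CompleteSpace H₂]
    (S : H₁ →L[𝕜] H₂) (T : H₂ →L[𝕜] H₁) (hST : IsFredholmPair S T) :
    ∃ ε : ℝ, 0 < ε ∧
      ∀ (S₁ : H₁ →L[𝕜] H₂) (T₁ : H₂ →L[𝕜] H₁),
        FiniteDimensional 𝕜 (LinearMap.range (T₁ ∘L S₁).toLinearMap) →
        FiniteDimensional 𝕜 (LinearMap.range (S₁ ∘L T₁).toLinearMap) →
        ‖S - S₁‖ < ε → ‖T - T₁‖ < ε →
          IsFredholmPair S₁ T₁ ∧ fredholmPairIndex S T = fredholmPairIndex S₁ T₁ := by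
  obtain ⟨hiff, hind⟩ := isFredholmPair_iff_add_adjoint_of_finiteDimensional_range
    hST.swap.finiteDimensional_range_comp hST.finiteDimensional_range_comp
  obtain ⟨ε, hε, hstab⟩ := (hiff.1 hST).exists_stable_of_zero
  -- Half of `ε` for each operator, since taking adjoints is isometric.
  refine ⟨ε / 2, half_pos hε, fun S₁ T₁ hTS₁ hST₁ hS hT ↦ ?_⟩
  obtain ⟨hiff₁, hind₁⟩ := isFredholmPair_iff_add_adjoint_of_finiteDimensional_range hTS₁ hST₁
  have hnorm : ‖(S + ContinuousLinearMap.adjoint T) - (S₁ + ContinuousLinearMap.adjoint T₁)‖ < ε :=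
    calc ‖(S + ContinuousLinearMap.adjoint T) - (S₁ + ContinuousLinearMap.adjoint T₁)‖
        = ‖(S - S₁) + ContinuousLinearMap.adjoint (T - T₁)‖ := by
          rw [map_sub, add_sub_add_comm]
      _ ≤ ‖S - S₁‖ + ‖T - T₁‖ := by
          refine (norm_add_le _ _).trans_eq ?_
          rw [LinearIsometryEquiv.norm_map]
      _ < ε := by linarith
  obtain ⟨hF₁, he⟩ := hstab _ hnorm
  have hpair := hiff₁.2 hF₁
  exact ⟨hpair, (hind hST).trans (he.trans (hind₁ hpair).symm)⟩
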